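/- Let $X$ be a real Banach space with dual $X^{*}$, and let $\tau=\tau(X^{*},X)$ be the Mackey topology on $X^{*}$, i.e. the topology of uniform convergence on the absolutely convex weakly compact subsets of $X$. Let $\tau^{+}$ be the finest locally convex topology on $X^{*}$ with the same convergent sequences as $\tau$, and let $\tau^{p}$ be the finest locally convex topology on $X^{*}$ with the same precompact sets as $\tau$. (A set $A$ is precompact for a vector space topology if for every neighbourhood $U$ of $0$ it is covered by finitely many translates of $U$.) Suppose that $(X^{*},\tau)$ is angelic, i.e. it is Hausdorff and, for every relatively countably compact subset $A$ (one in which every sequence has a $\tau$-cluster point in $X^{*}$), the closure $\overline{A}$ is compact and every point of $\overline{A}$ is the limit of a sequence in $A$. Then $\tau^{+}\preceq\tau^{p}$, that is, $\tau^{+}$ is coarser than (or equal to) $\tau^{p}$. Equivalently, every $\tau$-precompact subset of $X^{*}$ is $\tau^{+}$-precompact. -/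

import Mathlib

open Filter Topology Set Pointwise

/-- `A` is `T`-precompact: for every `T`-neighbourhood `U` of `0`, the set `A` is covered by
finitely many translates of `U`. -/
def IsPrecompactIn {E : Type*} [AddCommGroup E] (T : TopologicalSpace E) (A : Set E) : Prop :=
  ∀ U ∈ @nhds E T 0, ∃ F : Set E, F.Finite ∧ A ⊆ ⋃ y ∈ F, y +ᵥ U

/-- `IsPrecompactIn` is total boundedness for the uniform structure of the topological group
`(E, T)`, expressed through ultrafilters. -/
theorem isPrecompactIn_iff_ultrafilter {E : Type*} [AddCommGroup E] {T : TopologicalSpace E}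
    (hT : @IsTopologicalAddGroup E T _) (A : Set E) :
    IsPrecompactIn T A ↔ ∀ f : Ultrafilter E, A ∈ f →
      Tendsto (fun p : E × E => p.2 - p.1) ((f : Filter E) ×ˢ (f : Filter E)) (@nhds E T 0) := by
  let _ : TopologicalSpace E := T
  have : IsTopologicalAddGroup E := hT
  let _ : UniformSpace E := IsTopologicalAddGroup.rightUniformSpace E
  have : IsUniformAddGroup E := isUniformAddGroup_of_addCommGroup
  have h1 : IsPrecompactIn T A ↔ TotallyBounded A :=
    totallyBounded_iff_subset_finite_iUnion_nhds_zero.symm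
  rw [h1, totallyBounded_iff_ultrafilter]
  refine forall_congr' fun f => ?_
  rw [le_principal_iff]
  refine imp_congr Iff.rfl ?_
  rw [cauchy_iff_le, uniformity_eq_comap_nhds_zero E, tendsto_iff_comap]

section LocallyConvexTopologies

variable {E : Type*} [AddCommGroup E] [Module ℝ E]

/-- `T` is a locally convex vector space topology on the real vector space `E`. -/
structure IsLocallyConvexTopology (T : TopologicalSpace E) : Prop where
  addGroup : @IsTopologicalAddGroup E T _
  smul : @ContinuousSMul ℝ E _ _ T
  locallyConvex : @LocallyConvexSpace ℝ E _ _ _ _ T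

/-- `S` and `T` have the same convergent sequences (with the same limits). -/
def SameConvergentSequences (S T : TopologicalSpace E) : Prop :=
  ∀ (u : ℕ → E) (x : E), Tendsto u atTop (@nhds E S x) ↔ Tendsto u atTop (@nhds E T x)

/-- `S` and `T` have the same precompact sets. -/
def SamePrecompactSets (S T : TopologicalSpace E) : Prop :=
  ∀ A : Set E, IsPrecompactIn S A ↔ IsPrecompactIn T A

/-- The topology `τ⁺`: the finest locally convex topology with the same convergent sequences
as `τ`. In Mathlib's order `S ≤ T` means that `S` is finer than `T`, so `sInf` is the coarsest
topology finer than all the members of the set; that it is itself a member of the set is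
`isLeast_plusTopology`. -/
@[reducible]
def plusTopology (τ : TopologicalSpace E) : TopologicalSpace E :=
  sInf {T | IsLocallyConvexTopology T ∧ SameConvergentSequences T τ}

/-- The topology `τᵖ`: the finest locally convex topology with the same precompact sets as `τ`.
That it is itself a member of the set below is `isLeast_precompactTopology`. -/
@[reducible]
def precompactTopology (τ : TopologicalSpace E) : TopologicalSpace E :=
  sInf {T | IsLocallyConvexTopology T ∧ SamePrecompactSets T τ}

theorem IsLocallyConvexTopology.sInf {s : Set (TopologicalSpace E)}
    (h : ∀ T ∈ s, IsLocallyConvexTopology T) : IsLocallyConvexTopology (sInf s) where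
  addGroup := topologicalAddGroup_sInf fun T hT => (h T hT).addGroup
  smul := continuousSMul_sInf fun T hT => (h T hT).smul
  locallyConvex := LocallyConvexSpace.sInf fun T hT => (h T hT).locallyConvex

theorem isLeast_plusTopology {τ : TopologicalSpace E} (hτ : IsLocallyConvexTopology τ) :
    IsLeast {T | IsLocallyConvexTopology T ∧ SameConvergentSequences T τ} (plusTopology τ) := by
  refine ⟨⟨IsLocallyConvexTopology.sInf fun T hT => hT.1, fun u x => ?_⟩, fun T hT => sInf_le hT⟩
  simp only [nhds_sInf, tendsto_iInf]
  exact ⟨fun h => h τ ⟨hτ, fun _ _ => Iff.rfl⟩, fun h T hT => (hT.2 u x).2 h⟩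

theorem isLeast_precompactTopology {τ : TopologicalSpace E} (hτ : IsLocallyConvexTopology τ) :
    IsLeast {T | IsLocallyConvexTopology T ∧ SamePrecompactSets T τ} (precompactTopology τ) := by
  have hlc : IsLocallyConvexTopology (precompactTopology τ) :=
    IsLocallyConvexTopology.sInf fun T hT => hT.1
  refine ⟨⟨hlc, fun A => ?_⟩, fun T hT => sInf_le hT⟩
  rw [isPrecompactIn_iff_ultrafilter hlc.addGroup, isPrecompactIn_iff_ultrafilter hτ.addGroup]
  rw [precompactTopology, nhds_sInf]
  simp only [tendsto_iInf]
  refine ⟨fun h f hf => h f hf τ ⟨hτ, fun _ => Iff.rfl⟩, fun h f hf T hT => ?_⟩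
  exact (isPrecompactIn_iff_ultrafilter hT.1.addGroup A).1
    ((hT.2 A).2 ((isPrecompactIn_iff_ultrafilter hτ.addGroup A).2 h)) f hf

end LocallyConvexTopologies

/-- `A` is relatively countably compact: every sequence in `A` has a cluster point in the whole
space `S` (not necessarily in `A`). -/
def IsRelativelyCountablyCompact {S : Type*} (T : TopologicalSpace S) (A : Set S) : Prop :=
  ∀ u : ℕ → S, (∀ n, u n ∈ A) → ∃ x : S, MapClusterPt x atTop u

/-- The topology `T` on `S` is angelic: it is Hausdorff, and every relatively countably compact
set `A` is relatively compact and every point of its closure is the limit of a sequence in `A`. -/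
structure IsAngelic {S : Type*} (T : TopologicalSpace S) : Prop where
  t2 : T2Space S
  isCompact_closure : ∀ A : Set S, IsRelativelyCountablyCompact T A → IsCompact (closure A)
  exists_seq : ∀ A : Set S, IsRelativelyCountablyCompact T A → ∀ a ∈ closure A,
    ∃ u : ℕ → S, (∀ n, u n ∈ A) ∧ Tendsto u atTop (𝓝 a)

section MackeyDual

variable (X : Type*) [NormedAddCommGroup X] [NormedSpace ℝ X]

/-- The absolutely convex weakly compact subsets of `X`. -/
def weaklyCompactAbsConvexSets : Set (Set X) :=
  {K | AbsConvex ℝ K ∧ IsCompact (toWeakSpace ℝ X '' K)}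

/-- The Mackey topology `τ(X*, X)` on the dual `X*`: uniform convergence on the absolutely convex
weakly compact subsets of `X`. -/
@[reducible]
noncomputable def mackeyDualTopology : TopologicalSpace (StrongDual ℝ X) :=
  UniformConvergenceCLM.instTopologicalSpace (RingHom.id ℝ) ℝ (weaklyCompactAbsConvexSets X)

theorem isVonNBounded_of_mem_weaklyCompactAbsConvexSets {K : Set X}
    (hK : K ∈ weaklyCompactAbsConvexSets X) : Bornology.IsVonNBounded ℝ K := by
  rw [NormedSpace.isVonNBounded_iff, isBounded_iff_forall_norm_le]
  have h : ∀ f : StrongDual ℝ X, ∃ C, ∀ x : K,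
      ‖NormedSpace.inclusionInDoubleDualLi ℝ (E := X) (x : X) f‖ ≤ C := by
    intro f
    have hf : Continuous fun x : WeakSpace ℝ X => f ((toWeakSpace ℝ X).symm x) :=
      WeakBilin.eval_continuous (topDualPairing ℝ X).flip f
    obtain ⟨C, hC⟩ := hK.2.exists_bound_of_continuousOn hf.continuousOn
    exact ⟨C, fun x => hC _ (mem_image_of_mem _ x.2)⟩
  obtain ⟨C, hC⟩ := banach_steinhaus h
  exact ⟨C, fun x hx => by
    rw [← (NormedSpace.inclusionInDoubleDualLi ℝ (E := X)).norm_map x]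
    exact hC ⟨x, hx⟩⟩

theorem directedOn_weaklyCompactAbsConvexSets :
    DirectedOn (· ⊆ ·) (weaklyCompactAbsConvexSets X) := by
  rintro K ⟨hK, hKc⟩ L ⟨hL, hLc⟩
  rcases K.eq_empty_or_nonempty with rfl | hKn
  · exact ⟨L, ⟨hL, hLc⟩, empty_subset _, Subset.rfl⟩
  rcases L.eq_empty_or_nonempty with rfl | hLn
  · exact ⟨K, ⟨hK, hKc⟩, Subset.rfl, empty_subset _⟩
  refine ⟨K + L, ⟨⟨hK.1.add hL.1, hK.2.add hL.2⟩, ?_⟩, fun x hx => ?_, fun x hx => ?_⟩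
  · rw [image_add]
    exact hKc.add hLc
  · exact ⟨x, hx, 0, hL.1.zero_mem hLn, add_zero x⟩
  · exact ⟨0, hK.1.zero_mem hKn, x, hx, zero_add x⟩

theorem isLocallyConvexTopology_mackeyDualTopology :
    IsLocallyConvexTopology (mackeyDualTopology X) where
  addGroup := UniformConvergenceCLM.instIsTopologicalAddGroup (RingHom.id ℝ) ℝ _
  smul := UniformConvergenceCLM.continuousSMul (RingHom.id ℝ) ℝ (weaklyCompactAbsConvexSets X)
    fun _ hK => isVonNBounded_of_mem_weaklyCompactAbsConvexSets X hK
  locallyConvex := UniformConvergenceCLM.locallyConvexSpace ℝ (weaklyCompactAbsConvexSets X)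
    ⟨∅, ⟨balanced_empty, convex_empty⟩, by simp⟩ (directedOn_weaklyCompactAbsConvexSets X)

end MackeyDual

/-!
Let `τ` be the Mackey topology on the dual of a Banach space `X`. It is complete: every norm
convergent sequence lies, together with its limit, in an absolutely convex norm compact set, so a
limit of continuous functionals, uniform on the absolutely convex weakly compact sets, is
sequentially continuous for the norm (`completeSpace_mackeyDual`). Hence the `τ`-closure of a
`τ`-precompact set is `τ`-compact. In an angelic space compact sets are sequentially compact
(`IsAngelic.isSeqCompact`), and sequential compactness only depends on the convergent sequences of
the topology, so it passes from `τ` to `τ⁺`. Finally, a sequentially compact set is precompact.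

Thus every `τ`-precompact set is `τ⁺`-precompact. The converse holds as `τ⁺` is finer than `τ`, so
`τ⁺` has the same precompact sets as `τ`, and `τᵖ` is by definition finer than any such topology.
-/

theorem isPrecompactIn_iff_totallyBounded {E : Type*} [AddCommGroup E] [UniformSpace E]
    [IsUniformAddGroup E] {A : Set E} :
    IsPrecompactIn inferInstance A ↔ TotallyBounded A :=
  totallyBounded_iff_subset_finite_iUnion_nhds_zero.symm

theorem IsPrecompactIn.mono_topology {E : Type*} [AddCommGroup E] {S T : TopologicalSpace E}
    (hST : S ≤ T) {A : Set E} (hA : IsPrecompactIn S A) : IsPrecompactIn T A :=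
  fun U hU => hA U (nhds_mono hST hU)

theorem IsPrecompactIn.mono {E : Type*} [AddCommGroup E] {T : TopologicalSpace E} {A B : Set E}
    (hAB : A ⊆ B) (hB : IsPrecompactIn T B) : IsPrecompactIn T A :=
  fun U hU => let ⟨F, hF, h⟩ := hB U hU; ⟨F, hF, hAB.trans h⟩

theorem IsPrecompactIn.isCompact_closure {E : Type*} [AddCommGroup E] [UniformSpace E]
    [IsUniformAddGroup E] [CompleteSpace E] {A : Set E} (hA : IsPrecompactIn inferInstance A) :
    IsCompact (closure A) :=
  (isPrecompactIn_iff_totallyBounded.1 hA).closure.isCompact_of_isClosed isClosed_closure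

theorem IsSeqCompact.isPrecompactIn {E : Type*} [AddCommGroup E] [T : TopologicalSpace E]
    [IsTopologicalAddGroup E] {K : Set E} (hK : IsSeqCompact K) : IsPrecompactIn T K := by
  let _ : UniformSpace E := IsTopologicalAddGroup.rightUniformSpace E
  have : IsUniformAddGroup E := isUniformAddGroup_of_addCommGroup
  exact isPrecompactIn_iff_totallyBounded.2 hK.totallyBounded

theorem IsSeqCompact.of_sameConvergentSequences {E : Type*} [AddCommGroup E] [Module ℝ E]
    {S T : TopologicalSpace E} (h : SameConvergentSequences S T) {K : Set E}
    (hK : @IsSeqCompact E T K) : @IsSeqCompact E S K := by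
  intro u hu
  obtain ⟨a, ha, φ, hφ, hlim⟩ := hK hu
  exact ⟨a, ha, φ, hφ, (h _ a).2 hlim⟩

/-- In an angelic space a sequence with relatively countably compact range has a subsequence
converging to any prescribed cluster point of the sequence. -/
theorem IsAngelic.exists_subseq_tendsto {S : Type*} [T : TopologicalSpace S] (hT : IsAngelic T)
    {u : ℕ → S} (hu : IsRelativelyCountablyCompact T (range u)) {x : S}
    (hx : MapClusterPt x atTop u) :
    ∃ φ : ℕ → ℕ, StrictMono φ ∧ Tendsto (u ∘ φ) atTop (𝓝 x) := by
  have := hT.t2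
  by_cases hfreq : ∃ᶠ n in atTop, u n = x
  · obtain ⟨φ, hφ, h⟩ := extraction_of_frequently_atTop hfreq
    exact ⟨φ, hφ, tendsto_const_nhds.congr fun n => (h n).symm⟩
  rw [not_frequently] at hfreq
  have hcl : x ∈ closure (range u \ {x}) := by
    rw [mem_closure_iff_nhds]
    intro V hV
    obtain ⟨n, hn, hne⟩ := ((hx.frequently hV).and_eventually hfreq).exists
    exact ⟨u n, hn, mem_range_self n, hne⟩
  obtain ⟨v, hv, hvx⟩ :=
    hT.exists_seq (range u \ {x}) (fun w hw => hu w fun n => (hw n).1) x hcl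
  choose k hk using fun n => (hv n).1
  -- The finite set of values `u m ≠ x` with `m ≤ N` is closed, so `v = u ∘ k` eventually leaves it.
  have hk_top : Tendsto k atTop atTop := by
    refine tendsto_atTop.2 fun N => ?_
    have hfin : (u '' Iio N \ {x}).Finite := ((finite_Iio N).image u).subset sdiff_subset
    filter_upwards [hvx.eventually (hfin.isClosed.isOpen_compl.mem_nhds fun h => h.2 rfl)]
      with n hn
    by_contra hlt
    exact hn ⟨⟨k n, not_le.1 hlt, hk n⟩, (hv n).2⟩
  obtain ⟨φ, hφ, hkφ⟩ := strictMono_subseq_of_tendsto_atTop hk_top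
  refine ⟨k ∘ φ, hkφ, (hvx.comp hφ.tendsto_atTop).congr fun n => ?_⟩
  exact (hk (φ n)).symm

theorem IsAngelic.isSeqCompact {S : Type*} [T : TopologicalSpace S] (hT : IsAngelic T)
    {K : Set S} (hK : IsCompact K) : IsSeqCompact K := by
  have hclus : ∀ w : ℕ → S, (∀ n, w n ∈ K) → ∃ x ∈ K, MapClusterPt x atTop w := fun w hw =>
    hK.exists_mapClusterPt_of_frequently (Frequently.of_forall hw)
  intro u hu
  obtain ⟨x, hxK, hx⟩ := hclus u hu
  have hrange : IsRelativelyCountablyCompact T (range u) := fun w hw =>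
    let ⟨y, _, hy⟩ := hclus w fun n => range_subset_iff.2 hu (hw n)
    ⟨y, hy⟩
  exact ⟨x, hxK, hT.exists_subseq_tendsto hrange hx⟩

theorem IsCompact.closedAbsConvexHull_mem_weaklyCompactAbsConvexSets {X : Type*}
    [NormedAddCommGroup X] [NormedSpace ℝ X] [CompleteSpace X] {s : Set X} (hs : IsCompact s) :
    closedAbsConvexHull ℝ s ∈ weaklyCompactAbsConvexSets X :=
  ⟨absConvex_convexClosedHull, (isCompact_closedAbsConvexHull_of_totallyBounded
    hs.totallyBounded).image (toWeakSpaceCLM ℝ X).continuous⟩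

/-- The norm topology is determined by its restrictions to the absolutely convex weakly compact
sets, since these contain all convergent sequences with their limits. -/
theorem isCoherentWith_weaklyCompactAbsConvexSets (X : Type*) [NormedAddCommGroup X]
    [NormedSpace ℝ X] [CompleteSpace X] : IsCoherentWith (weaklyCompactAbsConvexSets X) :=
  (IsCoherentWith.of_seq (S := {K : Set X | IsCompact K})
    fun _ _ hux => hux.isCompact_insert_range).enlarge fun _ hs =>
      ⟨_, IsCompact.closedAbsConvexHull_mem_weaklyCompactAbsConvexSets hs,
        subset_closedAbsConvexHull⟩

/-- The dual of a Banach space is complete for the uniform structure of the Mackey topology. -/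
theorem completeSpace_mackeyDual (X : Type*) [NormedAddCommGroup X]
    [NormedSpace ℝ X] [CompleteSpace X] :
    @CompleteSpace (StrongDual ℝ X)
      (UniformConvergenceCLM.instUniformSpace (RingHom.id ℝ) ℝ (weaklyCompactAbsConvexSets X)) :=
  UniformConvergenceCLM.completeSpace (RingHom.id ℝ) ℝ
    (isCoherentWith_weaklyCompactAbsConvexSets X) <| eq_univ_of_forall fun x =>
      ⟨_, isCompact_singleton.closedAbsConvexHull_mem_weaklyCompactAbsConvexSets,
        subset_closedAbsConvexHull (mem_singleton x)⟩

theorem IsPrecompactIn.isCompact_closure_mackeyDual {X : Type*} [NormedAddCommGroup X]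
    [NormedSpace ℝ X] [CompleteSpace X] {A : Set (StrongDual ℝ X)}
    (hA : IsPrecompactIn (mackeyDualTopology X) A) :
    @IsCompact _ (mackeyDualTopology X) (@closure _ (mackeyDualTopology X) A) :=
  @IsPrecompactIn.isCompact_closure (StrongDual ℝ X) _
    (UniformConvergenceCLM.instUniformSpace (RingHom.id ℝ) ℝ (weaklyCompactAbsConvexSets X))
    (UniformConvergenceCLM.instIsUniformAddGroup (RingHom.id ℝ) ℝ (weaklyCompactAbsConvexSets X))
    (completeSpace_mackeyDual X) A hA

theorem theorem3p15 (X : Type*) [NormedAddCommGroup X] [NormedSpace ℝ X] [CompleteSpace X]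
    (hX : IsAngelic (mackeyDualTopology X)) :
    -- `τ⁺` is coarser than `τᵖ` (in Mathlib's order `S ≤ T` means that `S` is finer than `T`)
    precompactTopology (mackeyDualTopology X) ≤ plusTopology (mackeyDualTopology X) ∧
    ∀ A : Set (StrongDual ℝ X), IsPrecompactIn (mackeyDualTopology X) A →
      IsPrecompactIn (plusTopology (mackeyDualTopology X)) A := by
  have hτ := isLocallyConvexTopology_mackeyDualTopology X
  obtain ⟨⟨hlc, hseq⟩, hleast⟩ := isLeast_plusTopology hτ
  have key : ∀ A : Set (StrongDual ℝ X), IsPrecompactIn (mackeyDualTopology X) A →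
      IsPrecompactIn (plusTopology (mackeyDualTopology X)) A := fun A hA =>
    IsPrecompactIn.mono (@subset_closure _ (mackeyDualTopology X) A) <|
      @IsSeqCompact.isPrecompactIn _ _ (plusTopology (mackeyDualTopology X)) hlc.addGroup _ <|
        IsSeqCompact.of_sameConvergentSequences hseq <|
          @IsAngelic.isSeqCompact _ (mackeyDualTopology X) hX _ hA.isCompact_closure_mackeyDual
  have hle : plusTopology (mackeyDualTopology X) ≤ mackeyDualTopology X :=
    hleast ⟨hτ, fun _ _ => Iff.rfl⟩
  exact ⟨sInf_le ⟨hlc, fun A => ⟨fun h => h.mono_topology hle, key A⟩⟩, key⟩
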